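/- Let $\mathcal{G}=\{(G_i,d_i)\}_{i\in I}$ be a family of groups with bi-invariant metrics of uniformly bounded diameter. A group $\Gamma$ is \emph{$\mathcal{G}$-approximable} if there is $c>0$ such that for every finite $F\subseteq\Gamma$ and every $\epsilon>0$ there are $i\in I$ and a function $\varphi:\Gamma\to G_i$ with $\varphi(e)=e$; with $d_i(\varphi(gh),\varphi(g)\varphi(h))<\epsilon$ whenever $g,h,gh\in F$ (that is, $\varphi$ is \emph{$(F,\epsilon)$-multiplicative}); and with $d_i(\varphi(g),e)>c$ for all $e\neq g\in F$. The group $\Gamma$ is - \emph{sofic} if $\mathcal{G}$ is the family of symmetric groups $\mathrm{Sym}(n)$, $n\geq 1$, with the normalized Hamming metrics, where for a finite set $A$ and $\sigma,\tau\in\mathrm{Sym}(A)$, $d_A(\sigma,\tau)=1-\frac{1}{|A|}|\{a\in A:\sigma(a)=\tau(a)\}|$; - \emph{$\mathbb{K}$-linear sofic} (for a field $\mathbb{K}$) if $\mathcal{G}$ is the family of the groups $\mathrm{GL}_n(\mathbb{K})$, $n\geq 1$, with $d(M,N)=\frac1n\mathrm{rk}(M-N)$; - \emph{hyperlinear} if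 $\mathcal{G}$ is the family of the unitary groups $U(n)$, $n\geq 1$, with $d(M,N)=\sqrt{\frac1n\sum_{i,j}|M_{i,j}-N_{i,j}|^2}$; - \emph{weakly sofic} if $\mathcal{G}$ is the family of all finite groups equipped with bi-invariant metrics of diameter one. An action $\alpha$ of a group $\Gamma$ on a set $X$ is \emph{sofic} if for all finite $F\subseteq\Gamma$, $E\subseteq X$ and every $\epsilon>0$ there exist a finite set $A$ and a function $\varphi:\Gamma\to\mathrm{Sym}(A)$ with $\varphi(e)=e$ which is $(F,\epsilon)$-multiplicative with respect to $d_A$, together with a finite set $B$, a subset $S\subseteq A$ with $|S|>(1-\epsilon)|A|$, and injections $\pi_s:E\hookrightarrow B$ $(s\in S)$, such that for all $g\in F$, $x\in E$, $s\in S$ with $\varphi(g)s\in S$ and $\alpha(g)^{-1}x\in E$ one has $\pi_{\varphi(g)s}(x)=\pi_s(\alpha(g)^{-1}x)$. For a set $X$ let $\mathrm{Sym}_f(X)$ be the group of permutations of $X$ with finite support, and let $\mathrm{Alt}_f(X)\leq\mathrm{Sym}_f(X)$ be the subgroup of even permutations (products of an even number of transpositions). An action $\alpha$ of $\Gamma$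 on $X$ induces actions of $\Gamma$ on $\mathrm{Sym}_f(X)$ and on $\mathrm{Alt}_f(X)$ by automorphisms, $g\cdot\sigma=\alpha(g)\sigma\alpha(g)^{-1}$; the associated semidirect products $\mathrm{Sym}_f(X)\rtimes\Gamma$ and $\mathrm{Alt}_f(X)\rtimes\Gamma$ are the \emph{symmetric enrichment} and the \emph{alternating enrichment} of $\alpha$. \textbf{Theorem.} Let $\Gamma$ be a sofic (respectively $\mathbb{K}$-linear sofic for a field $\mathbb{K}$; hyperlinear; weakly sofic) group, and let $\alpha$ be a sofic action of $\Gamma$ on a set $X$. Then $\mathrm{Sym}_f(X)\rtimes\Gamma$ and $\mathrm{Alt}_f(X)\rtimes\Gamma$ are sofic (respectively $\mathbb{K}$-linear sofic; hyperlinear; weakly sofic) groups. -/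

import Mathlib

universe u v w

/-- The normalized Hamming distance on the permutations of a finite set `A`. -/
noncomputable def hammingMetric {A : Type u} [Fintype A] [DecidableEq A]
    (σ τ : Equiv.Perm A) : ℝ :=
  1 - ((Finset.univ.filter fun a => σ a = τ a).card : ℝ) / (Fintype.card A : ℝ)

/-- The normalized rank distance on `GL n K`. -/
noncomputable def rankMetric {K : Type u} [Field K] {n : ℕ}
    (M N : Matrix.GeneralLinearGroup (Fin n) K) : ℝ :=
  (((M : Matrix (Fin n) (Fin n) K) - (N : Matrix (Fin n) (Fin n) K)).rank : ℝ) / (n : ℝ)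

/-- The normalized Hilbert-Schmidt distance on the unitary group `U(n)`. -/
noncomputable def hilbertSchmidtMetric {n : ℕ}
    (M N : Matrix.unitaryGroup (Fin n) ℂ) : ℝ :=
  Real.sqrt ((1 / (n : ℝ)) * ∑ i, ∑ j,
    ‖(M : Matrix (Fin n) (Fin n) ℂ) i j - (N : Matrix (Fin n) (Fin n) ℂ) i j‖ ^ 2)

/-- `φ` is `(F, ε)`-multiplicative with respect to the distance `d`. -/
def IsAlmostMultiplicative {Γ : Type u} {G : Type v} [Group Γ] [Group G] (d : G → G → ℝ)
    (F : Finset Γ) (ε : ℝ) (φ : Γ → G) : Prop :=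
  ∀ g ∈ F, ∀ h ∈ F, g * h ∈ F → d (φ (g * h)) (φ g * φ h) < ε

/-- `φ` is `(F, c)`-separating with respect to the distance `d`. -/
def IsSeparating {Γ : Type u} {G : Type v} [Group Γ] [Group G] (d : G → G → ℝ)
    (F : Finset Γ) (c : ℝ) (φ : Γ → G) : Prop :=
  ∀ g ∈ F, g ≠ 1 → c < d (φ g) 1

/-- `Γ` is approximable by the family of groups `G i` with distances `d i`: for some `c > 0`,
every finite `F ⊆ Γ` and every `ε > 0` there is a unital, `(F, ε)`-multiplicative and
`(F, c)`-separating function from `Γ` to a member of the family. -/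
def IsMetricApproximable {I : Type v} (G : I → Type w) [∀ i, Group (G i)]
    (d : ∀ i, G i → G i → ℝ) (Γ : Type u) [Group Γ] : Prop :=
  ∃ c : ℝ, 0 < c ∧ ∀ (F : Finset Γ) (ε : ℝ), 0 < ε →
    ∃ (i : I) (φ : Γ → G i), φ 1 = 1 ∧ IsAlmostMultiplicative (d i) F ε φ ∧
      IsSeparating (d i) F c φ

/-- Sofic groups: approximable by the symmetric groups with the normalized Hamming metrics. -/
def IsSoficGroup (Γ : Type u) [Group Γ] : Prop :=
  IsMetricApproximable (fun n : ℕ+ => Equiv.Perm (Fin n)) (fun _ => hammingMetric) Γ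

/-- `K`-linear sofic groups: approximable by the groups `GL n K` with the normalized rank
metrics. -/
def IsLinearSoficGroup (K : Type w) [Field K] (Γ : Type u) [Group Γ] : Prop :=
  IsMetricApproximable (fun n : ℕ+ => Matrix.GeneralLinearGroup (Fin n) K)
    (fun _ => rankMetric) Γ

/-- Hyperlinear groups: approximable by the unitary groups `U(n)` with the normalized
Hilbert-Schmidt metrics. -/
def IsHyperlinearGroup (Γ : Type u) [Group Γ] : Prop :=
  IsMetricApproximable (fun n : ℕ+ => Matrix.unitaryGroup (Fin n) ℂ)
    (fun _ => hilbertSchmidtMetric) Γ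

/-- A finite group together with a bi-invariant metric of diameter one. -/
structure FiniteMetricGroup where
  carrier : Type
  group : Group carrier
  finite : Finite carrier
  d : carrier → carrier → ℝ
  d_eq_zero_iff : ∀ x y, d x y = 0 ↔ x = y
  d_comm : ∀ x y, d x y = d y x
  d_triangle : ∀ x y z, d x z ≤ d x y + d y z
  d_mul_left : ∀ g x y, d (g * x) (g * y) = d x y
  d_mul_right : ∀ g x y, d (x * g) (y * g) = d x y
  d_le_one : ∀ x y, d x y ≤ 1
  exists_d_eq_one : ∃ x y, d x y = 1

instance finiteMetricGroup_group (G : FiniteMetricGroup) : Group G.carrier := G.group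

/-- Weakly sofic groups: approximable by the finite groups with bi-invariant metrics of diameter
one. -/
def IsWeaklySoficGroup (Γ : Type u) [Group Γ] : Prop :=
  IsMetricApproximable FiniteMetricGroup.carrier FiniteMetricGroup.d Γ

/-- `φ` is an `(F, E, ε)`-orbit approximation of the action of `Γ` on `X`. -/
def IsOrbitApproximation {Γ : Type u} {X : Type v} [Group Γ] [MulAction Γ X]
    {A : Type} [Fintype A] (F : Finset Γ) (E : Finset X) (ε : ℝ)
    (φ : Γ → Equiv.Perm A) : Prop :=
  ∃ (B : Type) (_ : Finite B) (S : Finset A) (π : S → (E ↪ B)),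
    (1 - ε) * (Fintype.card A : ℝ) < (S.card : ℝ) ∧
    ∀ g ∈ F, ∀ (x : X) (hx : x ∈ E) (s : A) (hs : s ∈ S)
      (hgs : φ g s ∈ S) (hgx : g⁻¹ • x ∈ E),
      π ⟨φ g s, hgs⟩ ⟨x, hx⟩ = π ⟨s, hs⟩ ⟨g⁻¹ • x, hgx⟩

/-- The action of `Γ` on the set `X` is sofic. -/
def IsSoficAction (Γ : Type u) (X : Type v) [Group Γ] [MulAction Γ X] : Prop :=
  ∀ (F : Finset Γ) (E : Finset X) (ε : ℝ), 0 < ε →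
    ∃ (A : Type) (_ : Fintype A) (_ : DecidableEq A) (φ : Γ → Equiv.Perm A),
      φ 1 = 1 ∧ IsAlmostMultiplicative hammingMetric F ε φ ∧ IsOrbitApproximation F E ε φ

/-- `Sym_f(X)`: the group of permutations of `X` with finite support. -/
def finSym (X : Type v) : Subgroup (Equiv.Perm X) where
  carrier := {σ | {x | σ x ≠ x}.Finite}
  one_mem' := by simp
  mul_mem' := by
    intro σ τ hσ hτ
    refine (Set.Finite.union hσ hτ).subset ?_
    intro x hx
    by_contra h
    simp only [Set.mem_union, Set.mem_ofPred_eq, not_or, not_not] at h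
    exact hx (by rw [Equiv.Perm.mul_apply, h.2, h.1])
  inv_mem' := by
    intro σ hσ
    refine Set.Finite.subset hσ ?_
    intro x hx h
    exact hx (by rw [Equiv.Perm.inv_eq_iff_eq, h])

open Classical in
/-- `Alt_f(X)`: the group of even permutations of `X`, that is, of the products of an even number
of transpositions. -/
def finAlt (X : Type v) : Subgroup (Equiv.Perm X) where
  carrier := {σ | ∃ l : List (Equiv.Perm X), (∀ τ ∈ l, τ.IsSwap) ∧ Even l.length ∧ l.prod = σ}
  one_mem' := ⟨[], by simp⟩
  mul_mem' := by
    rintro _ _ ⟨l, hl, hle, rfl⟩ ⟨m, hm, hme, rfl⟩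
    refine ⟨l ++ m, ?_, ?_, List.prod_append⟩
    · intro τ hτ
      rcases List.mem_append.1 hτ with h | h
      exacts [hl τ h, hm τ h]
    · rw [List.length_append]
      exact hle.add hme
  inv_mem' := by
    rintro _ ⟨l, hl, hle, rfl⟩
    refine ⟨(l.map fun τ => τ⁻¹).reverse, ?_, by simpa using hle, (List.prod_inv_reverse l).symm⟩
    intro τ hτ
    obtain ⟨ρ, hρ, rfl⟩ := List.mem_map.1 (List.mem_reverse.1 hτ)
    obtain ⟨x, y, hxy, rfl⟩ := hl ρ hρ
    exact ⟨x, y, hxy, Equiv.swap_inv x y⟩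

theorem finAlt_le_finSym (X : Type v) : finAlt X ≤ finSym X := by
  classical
  rintro _ ⟨l, hl, -, rfl⟩
  refine Subgroup.list_prod_mem _ fun τ hτ => ?_
  obtain ⟨x, y, -, rfl⟩ := hl τ hτ
  refine (Set.toFinite {x, y}).subset ?_
  intro z hz
  by_contra h
  simp only [Set.mem_insert_iff, Set.mem_singleton_iff, not_or] at h
  exact hz (Equiv.swap_apply_of_ne_of_ne h.1 h.2)

instance finSym_normal (X : Type v) : (finSym X).Normal where
  conj_mem := by
    intro σ hσ ρ
    refine (Set.Finite.image ρ hσ).subset ?_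
    intro x hx
    refine ⟨ρ⁻¹ x, fun h => hx ?_, by simp⟩
    rw [Equiv.Perm.mul_apply, Equiv.Perm.mul_apply, h]
    simp

instance finAlt_normal (X : Type v) : (finAlt X).Normal where
  conj_mem := by
    classical
    rintro _ ⟨l, hl, hle, rfl⟩ ρ
    refine ⟨l.map (MulAut.conj ρ), ?_, by simpa using hle, ?_⟩
    · intro τ hτ
      obtain ⟨κ, hκ, rfl⟩ := List.mem_map.1 hτ
      obtain ⟨x, y, hxy, rfl⟩ := hl κ hκ
      refine ⟨ρ x, ρ y, fun h => hxy (ρ.injective h), ?_⟩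
      rw [MulAut.conj_apply, Equiv.swap_apply_apply]
    · rw [← map_list_prod, MulAut.conj_apply]

/-- The action of `Γ` by automorphisms on a normal subgroup `N` of the permutation group of `X`,
where `g` sends `σ` to `α(g) σ α(g)⁻¹` and `α(g)` is the permutation `x ↦ g • x`. -/
def conjAction (Γ : Type u) {X : Type v} [Group Γ] [MulAction Γ X]
    (N : Subgroup (Equiv.Perm X)) [N.Normal] : Γ →* MulAut N :=
  MulAut.conjNormal.comp (MulAction.toPermHom Γ X)

/-- The symmetric enrichment `Sym_f(X) ⋊ Γ` of the action of `Γ` on `X`. -/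
abbrev SymEnrichment (Γ : Type u) (X : Type v) [Group Γ] [MulAction Γ X] : Type (max v u) :=
  SemidirectProduct (finSym X) Γ (conjAction Γ (finSym X))

/-- The alternating enrichment `Alt_f(X) ⋊ Γ` of the action of `Γ` on `X`. -/
abbrev AltEnrichment (Γ : Type u) (X : Type v) [Group Γ] [MulAction Γ X] : Type (max v u) :=
  SemidirectProduct (finAlt X) Γ (conjAction Γ (finAlt X))

/-! ### Basic properties of the Hamming metric -/

section Hamming

/-! A sofic approximation `φ : Γ → Sym(A)` of the action carries a chart `π_s : E → B` at each `s ∈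
S`. Through `π_s`, a finitely supported `σ` becomes a permutation `θ_s(σ)` of `B`, and `(σ, g)` is
made to act on `A × Sym(B)` by `(s, c) ↦ (φ(g)s, θ_{φ(g)s}(σ) c)`. Compatibility of the charts says
that `gτg⁻¹` read at `φ(g)s` is `τ` read at `s`; this is the cocycle identity that makes the action
almost multiplicative.

Although `θ_s(σ)` may move only a few points of `B`, left translation by a non-trivial element of
`Sym(B)` fixes no point of `Sym(B)`. So a non-trivial `σ` moves every point over `S`, more than half
of all points, whatever its support (`exists_perm_approximation`).

Elements with non-trivial image in `Γ` are detected by an approximation of `Γ` itself. A direct sum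
of the two maps detects everything, so a class of groups needs only uniform representations of
finite symmetric groups and direct sums that lose a bounded factor
(`IsMetricApproximable.symEnrichment`). These are checked for each of the four classes. The
alternating enrichment is a subgroup of the symmetric one. -/

theorem hammingMetric_eq_card_ne {A : Type u} [Fintype A] [DecidableEq A] [Nonempty A]
    (σ τ : Equiv.Perm A) :
    hammingMetric σ τ
      = ((Finset.univ.filter fun a => σ a ≠ τ a).card : ℝ) / (Fintype.card A : ℝ) := by
  have h := Finset.card_filter_add_card_filter_not (s := (Finset.univ : Finset A))
    (fun a => σ a = τ a)
  have hA : (Fintype.card A : ℝ) ≠ 0 := Nat.cast_ne_zero.2 Fintype.card_ne_zero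
  rw [Finset.card_univ] at h
  rw [hammingMetric, eq_div_iff hA, sub_mul, div_mul_cancel₀ _ hA, ← h]
  push_cast
  ring

theorem hammingMetric_conj {A : Type u} {B : Type v} [Fintype A] [DecidableEq A] [Fintype B]
    [DecidableEq B] (e : A ≃ B) (σ τ : Equiv.Perm A) :
    hammingMetric (e.permCongrHom σ) (e.permCongrHom τ) = hammingMetric σ τ := by
  have h : (Finset.univ.filter fun b => e.permCongrHom σ b = e.permCongrHom τ b)
      = (Finset.univ.filter fun a => σ a = τ a).map e.toEmbedding := by
    ext b
    simp only [Finset.mem_filter, Finset.mem_univ, true_and, Finset.mem_map,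
      Equiv.coe_toEmbedding, Equiv.permCongrHom_coe, Equiv.permCongr_apply, e.apply_eq_iff_eq]
    exact ⟨fun hb => ⟨_, hb, e.apply_symm_apply b⟩, by rintro ⟨a, ha, rfl⟩; simpa using ha⟩
  rw [hammingMetric, hammingMetric, h, Finset.card_map, Fintype.card_congr e]

end Hamming

/-! ### Approximability of subgroups -/

section Subgroups

theorem IsMetricApproximable.of_injective {I : Type v} {G : I → Type w} [∀ i, Group (G i)]
    {d : ∀ i, G i → G i → ℝ} {Γ : Type u} [Group Γ] (h : IsMetricApproximable G d Γ)
    {Δ : Type*} [Group Δ] (f : Δ →* Γ) (hf : Function.Injective f) :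
    IsMetricApproximable G d Δ := by
  classical
  obtain ⟨c, hc, h⟩ := h
  refine ⟨c, hc, fun F ε hε => ?_⟩
  obtain ⟨i, φ, h1, hm, hs⟩ := h (F.image f) ε hε
  refine ⟨i, fun x => φ (f x), (congrArg φ (map_one f)).trans h1, fun g hg k hk hgk => ?_, fun g hg hg1 => ?_⟩
  · beta_reduce
    rw [map_mul]
    exact hm _ (Finset.mem_image_of_mem f hg) _ (Finset.mem_image_of_mem f hk)
      (by rw [← map_mul]; exact Finset.mem_image_of_mem f hgk)
  · exact hs _ (Finset.mem_image_of_mem f hg) fun h => hg1 (hf (h.trans (map_one f).symm))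

/-- The inclusion of the alternating enrichment into the symmetric enrichment. -/
def altToSymEnrichment (Γ : Type u) (X : Type v) [Group Γ] [MulAction Γ X] :
    AltEnrichment Γ X →* SymEnrichment Γ X :=
  SemidirectProduct.map (Subgroup.inclusion (finAlt_le_finSym X)) (MonoidHom.id Γ) (by
    intro g
    ext τ
    rfl)

theorem altToSymEnrichment_injective (Γ : Type u) (X : Type v) [Group Γ] [MulAction Γ X] :
    Function.Injective (altToSymEnrichment Γ X) := by
  intro p q h
  have hl : (altToSymEnrichment Γ X p).left = (altToSymEnrichment Γ X q).left := by rw [h]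
  have hr : (altToSymEnrichment Γ X p).right = (altToSymEnrichment Γ X q).right := by rw [h]
  exact SemidirectProduct.ext (Subgroup.inclusion_injective (finAlt_le_finSym X) hl) hr

end Subgroups

/-! ### Reading finitely supported permutations in a chart -/

section Transport

variable {X : Type v} {B : Type w}

open Classical in
/-- The permutation of `B` that corresponds, along the embedding `e` of `E` into `B`, to a
permutation of `X` that fixes all points outside `E` (and the identity for other permutations). -/
noncomputable def transportPerm {E : Finset X} (e : E ↪ B) (τ : Equiv.Perm X) : Equiv.Perm B :=
  if h : ∀ x, x ∈ E ↔ τ x ∈ E then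
    Equiv.Perm.viaEmbedding (τ.subtypePerm (p := fun x => x ∈ E) fun x => (h x).symm) e else 1

theorem mem_iff_apply_mem_of_support {E : Finset X} {τ : Equiv.Perm X}
    (h : ∀ x, τ x ≠ x → x ∈ E) (x : X) : x ∈ E ↔ τ x ∈ E := by
  by_cases hx : τ x = x
  · rw [hx]
  · exact iff_of_true (h x hx) (h _ fun h' => hx (τ.injective h'))

theorem transportPerm_apply {E : Finset X} (e : E ↪ B) {τ : Equiv.Perm X}
    (h : ∀ x, τ x ≠ x → x ∈ E) (x : E) :
    transportPerm e τ (e x) = e ⟨τ x, (mem_iff_apply_mem_of_support h x).1 x.2⟩ := by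
  rw [transportPerm, dif_pos (mem_iff_apply_mem_of_support h), Equiv.Perm.viaEmbedding_apply]
  rfl

theorem transportPerm_apply_eq_self {E : Finset X} (e : E ↪ B) {τ : Equiv.Perm X}
    (h : ∀ x, τ x ≠ x → x ∈ E) (b : B) (hb : ∀ x : E, τ x ≠ x → e x ≠ b) :
    transportPerm e τ b = b := by
  by_cases hr : b ∈ Set.range e
  · obtain ⟨x, rfl⟩ := hr
    rw [transportPerm_apply e h]
    congr 1
    by_contra hx
    exact hb x (fun h' => hx (Subtype.ext h')) rfl
  · rw [transportPerm, dif_pos (mem_iff_apply_mem_of_support h),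
      Equiv.Perm.viaEmbedding_apply_of_notMem _ _ _ hr]

theorem transportPerm_one {E : Finset X} (e : E ↪ B) : transportPerm e 1 = 1 :=
  Equiv.ext fun b => transportPerm_apply_eq_self e (fun _ h => absurd rfl h) b
    fun _ h => absurd rfl h

theorem transportPerm_mul {E : Finset X} (e : E ↪ B) {σ τ : Equiv.Perm X}
    (hσ : ∀ x, σ x ≠ x → x ∈ E) (hτ : ∀ x, τ x ≠ x → x ∈ E) :
    transportPerm e (σ * τ) = transportPerm e σ * transportPerm e τ := by
  have hστ : ∀ x, (σ * τ) x ≠ x → x ∈ E := by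
    intro x hx
    by_contra hE
    have h1 : τ x = x := by_contra fun h => hE (hτ x h)
    have h2 : σ x = x := by_contra fun h => hE (hσ x h)
    exact hx (by rw [Equiv.Perm.mul_apply, h1, h2])
  ext b
  by_cases hr : b ∈ Set.range e
  · obtain ⟨x, rfl⟩ := hr
    rw [Equiv.Perm.mul_apply, transportPerm_apply e hστ, transportPerm_apply e hτ,
      transportPerm_apply e hσ]
    rfl
  · have hb : ∀ x : E, e x ≠ b := fun x h => hr ⟨x, h⟩
    rw [Equiv.Perm.mul_apply, transportPerm_apply_eq_self e hστ b fun x _ => hb x,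
      transportPerm_apply_eq_self e hτ b fun x _ => hb x,
      transportPerm_apply_eq_self e hσ b fun x _ => hb x]

theorem transportPerm_ne_one {E : Finset X} (e : E ↪ B) {τ : Equiv.Perm X}
    (h : ∀ x, τ x ≠ x → x ∈ E) (hτ : τ ≠ 1) : transportPerm e τ ≠ 1 := by
  intro h1
  refine hτ (Equiv.ext fun x => by_contra fun hx => hx ?_)
  have h2 := transportPerm_apply e h ⟨x, h x hx⟩
  rw [h1, Equiv.Perm.one_apply] at h2
  exact (congrArg Subtype.val (e.injective h2)).symm

/-- Chart compatibility turned into equivariance: if `e'` at `ρ x` agrees with `e` at `x`, then both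
sides move the same points of `B` in the same way. The embeddings need to match only where `x` and
`ρ x` both lie in `E`, so the support of `τ` and its `ρ`-translate must lie in `E`. -/
theorem transportPerm_conj {E : Finset X} (e e' : E ↪ B) {τ ρ : Equiv.Perm X}
    (h : ∀ x, τ x ≠ x → x ∈ E) (h' : ∀ x, τ x ≠ x → ρ x ∈ E)
    (he : ∀ (x : X) (hx : x ∈ E) (hx' : ρ x ∈ E), e' ⟨ρ x, hx'⟩ = e ⟨x, hx⟩) :
    transportPerm e' (ρ * τ * ρ⁻¹) = transportPerm e τ := by
  have hc : ∀ x, (ρ * τ * ρ⁻¹) x ≠ x → x ∈ E := by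
    intro x hx
    have := h' (ρ⁻¹ x) fun h0 => hx (by
      rw [Equiv.Perm.mul_apply, Equiv.Perm.mul_apply, h0]
      exact ρ.apply_symm_apply _)
    simpa using this
  ext b
  by_cases hb : ∃ x : E, τ x ≠ x ∧ e x = b
  · obtain ⟨⟨x, hx⟩, hτx, rfl⟩ := hb
    have hτx' : τ (τ x) ≠ τ x := fun h0 => hτx (τ.injective h0)
    rw [transportPerm_apply e h, ← he x hx (h' x hτx), transportPerm_apply e' hc,
      ← he (τ x) (h _ hτx') (h' _ hτx')]
    congr 2
    simp
  · push Not at hb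
    rw [transportPerm_apply_eq_self e h b hb, transportPerm_apply_eq_self e' hc b]
    rintro ⟨y, hy⟩ hy1 rfl
    have hy2 : τ (ρ⁻¹ y) ≠ ρ⁻¹ y := fun h0 => hy1 (by
      rw [Equiv.Perm.mul_apply, Equiv.Perm.mul_apply, h0]
      exact ρ.apply_symm_apply _)
    refine hb ⟨ρ⁻¹ y, h _ hy2⟩ hy2 ?_
    rw [← he _ (h _ hy2) (h' _ hy2)]
    congr 2
    simp

end Transport

/-! ### Hamming distance on a product, fibre by fibre -/

section Core

variable {A : Type u} {C : Type v} [Fintype A] [Fintype C] [DecidableEq A] [DecidableEq C]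
  [Nonempty A] [Nonempty C]

theorem hammingMetric_prod_le (σ τ : Equiv.Perm (A × C)) (U : Finset A)
    (hU : ∀ s, s ∉ U → ∀ c, σ (s, c) = τ (s, c)) :
    hammingMetric σ τ ≤ (U.card : ℝ) / (Fintype.card A : ℝ) := by
  have hA : (0 : ℝ) < Fintype.card A := Nat.cast_pos.2 Fintype.card_pos
  have hC : (0 : ℝ) < Fintype.card C := Nat.cast_pos.2 Fintype.card_pos
  have h : (Finset.univ.filter fun a => σ a ≠ τ a) ⊆ U ×ˢ (Finset.univ : Finset C) := by
    rintro ⟨s, c⟩ hs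
    rw [Finset.mem_filter] at hs
    exact Finset.mem_product.2 ⟨by_contra fun h => hs.2 (hU s h c), Finset.mem_univ _⟩
  have h' := Finset.card_le_card h
  rw [Finset.card_product, Finset.card_univ] at h'
  rw [hammingMetric_eq_card_ne, Fintype.card_prod, div_le_div_iff₀ (by positivity) hA]
  have h2 : ((Finset.univ.filter fun a => σ a ≠ τ a).card : ℝ) ≤ U.card * Fintype.card C := by
    exact_mod_cast h'
  push_cast
  nlinarith

theorem le_hammingMetric_prod (σ τ : Equiv.Perm (A × C)) (U : Finset A)
    (hU : ∀ s ∈ U, ∀ c, σ (s, c) ≠ τ (s, c)) :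
    (U.card : ℝ) / (Fintype.card A : ℝ) ≤ hammingMetric σ τ := by
  have hA : (0 : ℝ) < Fintype.card A := Nat.cast_pos.2 Fintype.card_pos
  have hC : (0 : ℝ) < Fintype.card C := Nat.cast_pos.2 Fintype.card_pos
  have h : U ×ˢ (Finset.univ : Finset C) ⊆ (Finset.univ.filter fun a => σ a ≠ τ a) := by
    rintro ⟨s, c⟩ hs
    exact Finset.mem_filter.2 ⟨Finset.mem_univ _, hU s (Finset.mem_product.1 hs).1 c⟩
  have h' := Finset.card_le_card h
  rw [Finset.card_product, Finset.card_univ] at h'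
  rw [hammingMetric_eq_card_ne, Fintype.card_prod, div_le_div_iff₀ hA (by positivity)]
  have h2 : (U.card * Fintype.card C : ℝ) ≤ (Finset.univ.filter fun a => σ a ≠ τ a).card := by
    exact_mod_cast h'
  push_cast
  nlinarith

end Core

/-! ### The almost-action of the enrichment and the general criterion -/

theorem card_filter_apply_notMem {A : Type u} [Fintype A] [DecidableEq A] (ρ : Equiv.Perm A) (S : Finset A) :
    ((Finset.univ.filter fun s => ρ s ∉ S).card : ℝ) = Fintype.card A - S.card := by
  have h : (Finset.univ.filter fun s => ρ s ∉ S) = Sᶜ.map ρ.symm.toEmbedding := by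
    ext s
    simp [Finset.mem_map_equiv]
  rw [h, Finset.card_map, Finset.card_compl, Nat.cast_sub (Finset.card_le_univ S)]

open Classical in
/-- The symmetric enrichment of a sofic action is almost represented by permutations, in such a
way that the non-trivial elements of `Sym_f(X)` move more than half of the points. -/
theorem exists_perm_approximation {Γ : Type u} [Group Γ] {X : Type v} [MulAction Γ X]
    (hα : IsSoficAction Γ X) (F : Finset (SymEnrichment Γ X)) (ε : ℝ) (hε : 0 < ε) :
    ∃ (A : Type) (_ : Fintype A) (_ : DecidableEq A) (_ : Nonempty A)
      (Θ : SymEnrichment Γ X → Equiv.Perm A), Θ 1 = 1 ∧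
      IsAlmostMultiplicative hammingMetric F ε Θ ∧
      ∀ p ∈ F, p.right = 1 → p ≠ 1 → 1 / 2 < hammingMetric (Θ p) 1 := by
  let F₀ : Finset Γ := F.image fun p => p.right
  have hF₀ : ∀ p ∈ F, p.right ∈ F₀ := fun p hp => Finset.mem_image_of_mem _ hp
  let E₀ : Finset X := F.biUnion fun p => Set.Finite.toFinset (s := {x | p.left.1 x ≠ x}) p.left.2
  have hE₀ : ∀ p ∈ F, ∀ x, p.left.1 x ≠ x → x ∈ E₀ := fun p hp x hx =>
    Finset.mem_biUnion.2 ⟨p, hp, (Set.Finite.mem_toFinset _).2 hx⟩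
  -- Charts must see the supports for products, and also their translates by `F₀` for conjugates.
  let E : Finset X := E₀ ∪ (F₀ ×ˢ E₀).image fun y => y.1 • y.2
  have hE : ∀ p ∈ F, ∀ x, p.left.1 x ≠ x → x ∈ E := fun p hp x hx =>
    Finset.mem_union_left _ (hE₀ p hp x hx)
  have hE' : ∀ p ∈ F, ∀ g ∈ F₀, ∀ x, p.left.1 x ≠ x → g • x ∈ E := fun p hp g hg x hx =>
    Finset.mem_union_right _ (Finset.mem_image.2
      ⟨(g, x), Finset.mem_product.2 ⟨hg, hE₀ p hp x hx⟩, rfl⟩)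
  -- Three exceptional sets of density below `δ` spoil multiplicativity; `δ ≤ 1/2` makes `S` more
  -- than half of `A`.
  obtain ⟨δ, hδ, hδε, hδ2⟩ : ∃ δ : ℝ, 0 < δ ∧ 3 * δ ≤ ε ∧ δ ≤ 1 / 2 :=
    ⟨min (ε / 3) (1 / 2), by positivity, by linarith [min_le_left (ε / 3) (1 / 2)],
      min_le_right _ _⟩
  obtain ⟨A, iA, dA, φ, hφ1, hφm, B, iB, S, π, hS, hπ⟩ := hα F₀ E δ hδ
  -- The strict bound on the size of `S` fails for empty `A`.
  have hA : Nonempty A := by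
    by_contra h
    rw [not_nonempty_iff] at h
    simp [Finset.eq_empty_of_isEmpty S] at hS
  have hA0 : (0 : ℝ) < Fintype.card A := Nat.cast_pos.2 Fintype.card_pos
  have : Fintype B := Fintype.ofFinite B
  let θ : A → Equiv.Perm X → Equiv.Perm B := fun s τ =>
    if hs : s ∈ S then transportPerm (π ⟨s, hs⟩) τ else 1
  -- The chart is taken at the target point `φ(g)s`, since in `(σ, g)` the element `g` acts first.
  let Θ : SymEnrichment Γ X → Equiv.Perm (A × Equiv.Perm B) := fun p =>
    Equiv.prodShear (φ p.right) fun s => Equiv.mulLeft (θ (φ p.right s) p.left.1)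
  have hΘ : ∀ p s c, Θ p (s, c) = (φ p.right s, θ (φ p.right s) p.left.1 * c) :=
    fun _ _ _ => rfl
  refine ⟨A × Equiv.Perm B, inferInstance, inferInstance, inferInstance, Θ, ?_, ?_, ?_⟩
  · ext1 ⟨s, c⟩
    rw [hΘ]
    have h1 : θ s 1 = 1 := by
      by_cases hs : s ∈ S
      · simp only [θ, dif_pos hs, transportPerm_one]
      · simp only [θ, dif_neg hs]
    simp [hφ1, h1]
  · intro p hp q hq hpq
    let U₁ : Finset A := Finset.univ.filter fun s =>
      φ (p.right * q.right) s ≠ (φ p.right * φ q.right) s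
    let U₂ : Finset A := Finset.univ.filter fun s => φ q.right s ∉ S
    let U₃ : Finset A := Finset.univ.filter fun s => (φ p.right * φ q.right) s ∉ S
    have h1 : (U₁.card : ℝ) < δ * Fintype.card A := by
      have h := hφm _ (hF₀ p hp) _ (hF₀ q hq) (hF₀ _ hpq)
      rwa [hammingMetric_eq_card_ne, div_lt_iff₀ hA0] at h
    have h2 : (U₂.card : ℝ) < δ * Fintype.card A := by
      have h := card_filter_apply_notMem (φ q.right) S
      simp only [U₂]
      linarith
    have h3 : (U₃.card : ℝ) < δ * Fintype.card A := by
      have h := card_filter_apply_notMem (φ p.right * φ q.right) S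
      simp only [U₃]
      linarith
    have hU : ((U₁ ∪ U₂ ∪ U₃).card : ℝ) ≤ U₁.card + U₂.card + U₃.card := by
      have ha := Finset.card_union_le (U₁ ∪ U₂) U₃
      have hb := Finset.card_union_le U₁ U₂
      exact_mod_cast ha.trans (Nat.add_le_add_right hb _)
    refine (hammingMetric_prod_le _ _ (U₁ ∪ U₂ ∪ U₃) ?_).trans_lt ?_
    · intro s hs c
      simp only [U₁, U₂, U₃, Finset.mem_union, Finset.mem_filter, Finset.mem_univ, true_and,
        not_or, not_not] at hs
      obtain ⟨⟨hs1, hs2⟩, hs3⟩ := hs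
      rw [Equiv.Perm.mul_apply] at hs1 hs3
      have hl : (p * q).left.1 = p.left.1 * (MulAction.toPerm p.right * q.left.1 *
          (MulAction.toPerm p.right)⁻¹) := rfl
      -- The cocycle identity, valid when both `φ(q)s` and `φ(p)φ(q)s` carry charts.
      have hθ : θ (φ p.right (φ q.right s)) (p * q).left.1
          = θ (φ p.right (φ q.right s)) p.left.1 * θ (φ q.right s) q.left.1 := by
        simp only [θ, dif_pos hs3, dif_pos hs2]
        rw [hl, transportPerm_mul _ (hE p hp), transportPerm_conj (π ⟨_, hs2⟩) _ (hE q hq)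
          (hE' q hq _ (hF₀ p hp))]
        · intro x hx hx'
          -- The orbit condition is used at the point `g • x`, whose `g⁻¹`-translate is `x`.
          have h := hπ _ (hF₀ p hp) _ hx' _ hs2 hs3 (by simpa using hx)
          refine h.trans ?_
          congr 2
          exact inv_smul_smul _ _
        · intro x hx
          have := hE' q hq _ (hF₀ p hp) ((MulAction.toPerm p.right)⁻¹ x) fun h0 => hx (by
            rw [Equiv.Perm.mul_apply, Equiv.Perm.mul_apply, h0]
            exact Equiv.apply_symm_apply _ _)
          exact (smul_inv_smul p.right x) ▸ this
      rw [Equiv.Perm.mul_apply, hΘ, hΘ, hΘ, SemidirectProduct.mul_right, hs1, hθ, mul_assoc]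
    · rw [div_lt_iff₀ hA0]
      nlinarith
  · intro p hp hp1 hpne
    have hl : p.left.1 ≠ 1 := fun h => hpne (SemidirectProduct.ext (Subtype.ext h) hp1)
    refine lt_of_lt_of_le ?_ (le_hammingMetric_prod _ _ S ?_)
    · rw [lt_div_iff₀ hA0]
      nlinarith
    · intro s hs c h
      rw [hΘ, hp1, hφ1, Equiv.Perm.one_apply, Equiv.Perm.one_apply] at h
      -- A left translation with a fixed point is trivial.
      have h2 : θ s p.left.1 = 1 := mul_eq_right.1 (congrArg Prod.snd h)
      simp only [θ, dif_pos hs] at h2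
      exact transportPerm_ne_one _ (hE p hp) hl h2

/-- If the members of a family of groups with distances receive representations of the finite
symmetric groups that are compatible with the Hamming metrics, and direct sums of each other, then
approximability by the family passes to symmetric enrichments of sofic actions. -/
theorem IsMetricApproximable.symEnrichment {I : Type*} {G : I → Type w} [∀ i, Group (G i)]
    {d : ∀ i, G i → G i → ℝ}
    (hperm : ∃ κ : ℝ, 0 < κ ∧ ∀ δ : ℝ, 0 < δ → ∃ δ' : ℝ, 0 < δ' ∧
      ∀ (A : Type) [Fintype A] [DecidableEq A] [Nonempty A],
        ∃ (i : I) (ρ : Equiv.Perm A →* G i),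
          (∀ σ τ, hammingMetric σ τ < δ' → d i (ρ σ) (ρ τ) < δ) ∧
          ∀ σ, 1 / 2 < hammingMetric σ 1 → κ < d i (ρ σ) 1)
    (hsum : ∀ i j, ∃ (k : I) (ρ : G i × G j →* G k),
      (∀ (p q : G i × G j) (δ : ℝ), d i p.1 q.1 < δ → d j p.2 q.2 < δ → d k (ρ p) (ρ q) < δ) ∧
      ∀ p, 1 / 2 * d i p.1 1 ≤ d k (ρ p) 1 ∧ 1 / 2 * d j p.2 1 ≤ d k (ρ p) 1)
    {Γ : Type u} [Group Γ] {X : Type v} [MulAction Γ X]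
    (hα : IsSoficAction Γ X) (hΓ : IsMetricApproximable G d Γ) :
    IsMetricApproximable G d (SymEnrichment Γ X) := by
  classical
  obtain ⟨c, hc, hΓ⟩ := hΓ
  obtain ⟨κ, hκ, hperm⟩ := hperm
  -- The factor `1/2` is the loss in the direct sum.
  refine ⟨1 / 2 * min c κ, by positivity, fun F ε hε => ?_⟩
  obtain ⟨δ, hδ, hperm⟩ := hperm ε hε
  obtain ⟨A, _, _, _, Θ, hΘ1, hΘm, hΘs⟩ := exists_perm_approximation hα F δ hδ
  obtain ⟨i, ρ, hρm, hρs⟩ := hperm A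
  obtain ⟨j, ψ, hψ1, hψm, hψs⟩ := hΓ (F.image fun p => p.right) ε hε
  obtain ⟨k, η, hηm, hηs⟩ := hsum i j
  have hF : ∀ p ∈ F, p.right ∈ F.image fun p => p.right := fun p hp =>
    Finset.mem_image_of_mem _ hp
  refine ⟨k, fun p => η (ρ (Θ p), ψ p.right), ?_, ?_, ?_⟩
  · simp only [hΘ1, SemidirectProduct.one_right, hψ1, map_one]
    exact map_one η
  · intro p hp q hq hpq
    beta_reduce
    rw [← map_mul]
    refine hηm _ _ _ ?_ (hψm _ (hF p hp) _ (hF q hq) (hF _ hpq))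
    have h := hρm _ _ (hΘm p hp q hq hpq)
    rwa [map_mul] at h
  · intro p hp hp1
    have hs := hηs (ρ (Θ p), ψ p.right)
    -- With trivial image in `Γ` the permutation summand separates; otherwise the approximation of
    -- `Γ` does.
    by_cases hr : p.right = 1
    · have h := hρs _ (hΘs p hp hr hp1)
      linarith [hs.1, min_le_right c κ]
    · have h := hψs _ (hF p hp) hr
      linarith [hs.2, min_le_left c κ]

/-! ### Sofic groups -/

section Sofic

theorem exists_equiv_fin_pnat (A : Type*) [Fintype A] [Nonempty A] :
    ∃ n : ℕ+, Nonempty (A ≃ Fin n) :=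
  ⟨⟨Fintype.card A, Fintype.card_pos⟩, ⟨Fintype.equivFin A⟩⟩

theorem exists_perm_fin_hom {H : Type*} [Group H] {A : Type*} [Fintype A] [DecidableEq A]
    [Nonempty A] (f : H →* Equiv.Perm A) :
    ∃ (n : ℕ+) (ρ : H →* Equiv.Perm (Fin n)),
      ∀ x y, hammingMetric (ρ x) (ρ y) = hammingMetric (f x) (f y) := by
  obtain ⟨n, ⟨e⟩⟩ := exists_equiv_fin_pnat A
  exact ⟨n, (e.permCongrHom : Equiv.Perm A →* _).comp f, fun x y => hammingMetric_conj e (f x) (f y)⟩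

/-- The direct sum of permutation actions on `A` and `B`, repeated so that both summands have the
same size. -/
def permAmplifiedSum (A : Type u) (B : Type v) :
    Equiv.Perm A × Equiv.Perm B →* Equiv.Perm (A × B ⊕ B × A) where
  toFun p := Equiv.sumCongr (Equiv.prodCongr p.1 (Equiv.refl B)) (Equiv.prodCongr p.2 (Equiv.refl A))
  map_one' := by ext1 x; rcases x with x | x <;> rfl
  map_mul' p q := by ext1 x; rcases x with x | x <;> rfl

/-- The two summands have the same number of points, so the distance is the plain average. -/
theorem hammingMetric_permAmplifiedSum {A : Type u} {B : Type v} [Fintype A] [Fintype B]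
    [DecidableEq A] [DecidableEq B] [Nonempty A] [Nonempty B] (p q : Equiv.Perm A × Equiv.Perm B) :
    hammingMetric (permAmplifiedSum A B p) (permAmplifiedSum A B q)
      = (hammingMetric p.1 q.1 + hammingMetric p.2 q.2) / 2 := by
  have hA : (Fintype.card A : ℝ) ≠ 0 := Nat.cast_ne_zero.2 Fintype.card_ne_zero
  have hB : (Fintype.card B : ℝ) ≠ 0 := Nat.cast_ne_zero.2 Fintype.card_ne_zero
  simp only [hammingMetric_eq_card_ne, Finset.card_filter, Fintype.sum_sum_type,
    Fintype.sum_prod_type, permAmplifiedSum, MonoidHom.coe_mk, OneHom.coe_mk,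
    Equiv.sumCongr_apply, Sum.map_inl, Sum.map_inr, Equiv.prodCongr_apply, Prod.map_apply,
    Equiv.refl_apply, ne_eq, Sum.inl.injEq, Sum.inr.injEq, Prod.mk.injEq, and_true,
    Finset.sum_const, Finset.card_univ, smul_eq_mul, ← Finset.mul_sum, Fintype.card_sum,
    Fintype.card_prod]
  push_cast
  field_simp
  ring

theorem hammingMetric_nonneg {A : Type u} [Fintype A] [DecidableEq A] [Nonempty A]
    (σ τ : Equiv.Perm A) : 0 ≤ hammingMetric σ τ := by
  rw [hammingMetric_eq_card_ne]
  positivity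

theorem IsSoficGroup.symEnrichment {Γ : Type u} [Group Γ] {X : Type v} [MulAction Γ X]
    (hα : IsSoficAction Γ X) (hΓ : IsSoficGroup Γ) : IsSoficGroup (SymEnrichment Γ X) := by
  refine IsMetricApproximable.symEnrichment ⟨1 / 2, by norm_num, fun δ hδ => ⟨δ, hδ, ?_⟩⟩ ?_ hα hΓ
  · intro A _ _ _
    obtain ⟨n, ρ, hρ⟩ := exists_perm_fin_hom (MonoidHom.id (Equiv.Perm A))
    refine ⟨n, ρ, fun σ τ h => (hρ σ τ).trans_lt h, fun σ h => ?_⟩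
    rw [← map_one ρ, hρ]
    exact h
  · intro m n
    obtain ⟨k, ρ, hρ⟩ := exists_perm_fin_hom (permAmplifiedSum (Fin m) (Fin n))
    refine ⟨k, ρ, fun p q δ h1 h2 => ?_, fun p => ?_⟩
    · rw [hρ, hammingMetric_permAmplifiedSum]
      linarith
    · rw [← map_one ρ, hρ, hammingMetric_permAmplifiedSum, Prod.fst_one, Prod.snd_one]
      have h1 := hammingMetric_nonneg p.1 1
      have h2 := hammingMetric_nonneg p.2 1
      constructor <;> linarith

end Sofic

/-! ### Weakly sofic groups -/

section WeaklySofic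

/-- A permutation group with the Hamming metric. -/
noncomputable def permMetricGroup (A : Type) [Fintype A] [DecidableEq A] [Nonempty A]
    (h : ∃ σ : Equiv.Perm A, ∀ a, σ a ≠ a) : FiniteMetricGroup where
  carrier := Equiv.Perm A
  group := inferInstance
  finite := inferInstance
  d := hammingMetric
  d_eq_zero_iff σ τ := by
    rw [hammingMetric_eq_card_ne, div_eq_zero_iff, or_iff_left (by simp), Nat.cast_eq_zero,
      Finset.card_eq_zero, Finset.filter_eq_empty_iff, Equiv.ext_iff]
    simp
  d_comm σ τ := by simp only [hammingMetric, eq_comm]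
  d_triangle ρ σ τ := by
    have h : (Finset.univ.filter fun a => ρ a ≠ τ a) ⊆
        (Finset.univ.filter fun a => ρ a ≠ σ a) ∪ Finset.univ.filter fun a => σ a ≠ τ a := by
      intro a
      simp only [Finset.mem_filter, Finset.mem_univ, true_and, Finset.mem_union]
      intro ha
      by_contra! h
      exact ha (h.1.trans h.2)
    simp only [hammingMetric_eq_card_ne, ← add_div]
    gcongr
    exact_mod_cast (Finset.card_le_card h).trans (Finset.card_union_le _ _)
  d_mul_left ρ σ τ := by simp [hammingMetric]
  d_mul_right ρ σ τ := by
    have h : (Finset.univ.filter fun a => (σ * ρ) a = (τ * ρ) a)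
        = (Finset.univ.filter fun a => σ a = τ a).map ρ.symm.toEmbedding := by
      ext a
      simp only [Finset.mem_map_equiv, Finset.mem_filter, Finset.mem_univ, true_and]
      rfl
    rw [hammingMetric, hammingMetric, h, Finset.card_map]
  d_le_one σ τ := by
    rw [hammingMetric]
    have : (0 : ℝ) ≤ ((Finset.univ.filter fun a => σ a = τ a).card : ℝ) / Fintype.card A := by
      positivity
    linarith
  exists_d_eq_one := by
    obtain ⟨σ, hσ⟩ := h
    exact ⟨σ, 1, by simp [hammingMetric, hσ]⟩

theorem FiniteMetricGroup.d_nonneg (G : FiniteMetricGroup) (x y : G.carrier) : 0 ≤ G.d x y := by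
  have := G.d_triangle x y x
  rw [G.d_comm y x, (G.d_eq_zero_iff x x).2 rfl] at this
  linarith

/-- The product of two finite metric groups with the maximum metric. -/
def FiniteMetricGroup.prod (G H : FiniteMetricGroup) : FiniteMetricGroup where
  carrier := G.carrier × H.carrier
  group := inferInstance
  finite := by
    have := G.finite
    have := H.finite
    infer_instance
  d x y := max (G.d x.1 y.1) (H.d x.2 y.2)
  d_eq_zero_iff x y := by
    rw [Prod.ext_iff, ← G.d_eq_zero_iff, ← H.d_eq_zero_iff]
    refine ⟨fun h => ⟨?_, ?_⟩, fun h => by rw [h.1, h.2, max_self]⟩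
    · exact le_antisymm ((le_max_left _ _).trans h.le) (G.d_nonneg _ _)
    · exact le_antisymm ((le_max_right _ _).trans h.le) (H.d_nonneg _ _)
  d_comm x y := by rw [G.d_comm, H.d_comm]
  d_triangle x y z := max_le
    ((G.d_triangle _ y.1 _).trans (add_le_add (le_max_left _ _) (le_max_left _ _)))
    ((H.d_triangle _ y.2 _).trans (add_le_add (le_max_right _ _) (le_max_right _ _)))
  d_mul_left g x y := congrArg₂ max (G.d_mul_left _ _ _) (H.d_mul_left _ _ _)
  d_mul_right g x y := congrArg₂ max (G.d_mul_right _ _ _) (H.d_mul_right _ _ _)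
  d_le_one x y := max_le (G.d_le_one _ _) (H.d_le_one _ _)
  exists_d_eq_one := by
    obtain ⟨x, y, h⟩ := G.exists_d_eq_one
    exact ⟨(x, 1), (y, 1), le_antisymm (max_le (G.d_le_one _ _) (H.d_le_one _ _))
      (h ▸ le_max_left _ _)⟩

theorem IsWeaklySoficGroup.symEnrichment {Γ : Type u} [Group Γ] {X : Type v} [MulAction Γ X]
    (hα : IsSoficAction Γ X) (hΓ : IsWeaklySoficGroup Γ) :
    IsWeaklySoficGroup (SymEnrichment Γ X) := by
  refine IsMetricApproximable.symEnrichment ⟨1 / 4, by norm_num, fun δ hδ => ⟨δ, hδ, ?_⟩⟩ ?_ hα hΓ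
  · intro A _ _ _
    -- Doubling keeps distances and provides a fixed-point-free permutation, the exchange of the
    -- summands. Diameter exactly one requires one, and `A` itself may be a single point.
    let S := permAmplifiedSum A A
    let ρ : Equiv.Perm A →* Equiv.Perm (A × A ⊕ A × A) :=
      S.comp ((MonoidHom.id _).prod (MonoidHom.id _))
    have hρ : ∀ σ τ, hammingMetric (ρ σ) (ρ τ) = hammingMetric σ τ := fun σ τ =>
      (hammingMetric_permAmplifiedSum (σ, σ) (τ, τ)).trans (by ring)
    refine ⟨permMetricGroup (A × A ⊕ A × A) ⟨Equiv.sumComm _ _, by rintro (a | a) <;> simp⟩, ρ,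
      fun σ τ h => (hρ σ τ).trans_lt h, fun σ h => ?_⟩
    have h1 : hammingMetric (ρ σ) 1 = hammingMetric σ 1 := by rw [← map_one ρ, hρ]
    change 1 / 4 < hammingMetric (ρ σ) 1
    linarith
  · intro G H
    refine ⟨G.prod H, MonoidHom.id _, fun p q δ h1 h2 => max_lt h1 h2, fun p => ?_⟩
    have h1 := G.d_nonneg p.1 1
    have h2 := H.d_nonneg p.2 1
    have h3 : G.d p.1 1 ≤ (G.prod H).d p 1 := le_max_left _ _
    have h4 : H.d p.2 1 ≤ (G.prod H).d p 1 := le_max_right _ _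
    change 1 / 2 * _ ≤ (G.prod H).d p 1 ∧ 1 / 2 * _ ≤ (G.prod H).d p 1
    constructor <;> linarith

end WeaklySofic

/-! ### Rank and Hilbert-Schmidt distances of permutation matrices -/

section PermutationMatrices

/-- The representation of permutations by permutation matrices. -/
def permRep (A : Type u) (R : Type v) [Fintype A] [DecidableEq A] [Semiring R] :
    Equiv.Perm A →* Matrix A A R where
  toFun σ := Matrix.of fun i j => if i = σ j then 1 else 0
  map_one' := by
    ext i j
    exact (Matrix.one_apply (i := i) (j := j)).symm
  map_mul' σ τ := by
    ext i j
    rw [Matrix.mul_apply]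
    change (if i = σ (τ j) then (1 : R) else 0)
      = ∑ k, (if i = σ k then 1 else 0) * if k = τ j then 1 else 0
    rw [Finset.sum_eq_single (τ j) (fun k _ hk => by rw [if_neg hk, mul_zero]) (by simp),
      if_pos rfl, mul_one]

theorem permRep_apply {A : Type u} {R : Type v} [Fintype A] [DecidableEq A] [Semiring R]
    (σ : Equiv.Perm A) (i j : A) : permRep A R σ i j = if i = σ j then 1 else 0 := rfl

theorem permRep_mul_star (A : Type u) [Fintype A] [DecidableEq A] (σ : Equiv.Perm A) :
    permRep A ℂ σ * star (permRep A ℂ σ) = 1 := by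
  have h : star (permRep A ℂ σ) = permRep A ℂ σ⁻¹ := by
    ext i j
    rw [Matrix.star_apply, permRep_apply, permRep_apply]
    simp [eq_comm, Equiv.Perm.inv_def, Equiv.eq_symm_apply]
  rw [h, ← map_mul, mul_inv_cancel, map_one]

theorem rank_permRep_sub_le {A : Type u} {K : Type v} [Fintype A] [DecidableEq A] [Field K]
    (σ τ : Equiv.Perm A) :
    (permRep A K σ - permRep A K τ).rank ≤ (Finset.univ.filter fun a => σ a ≠ τ a).card := by
  -- The columns at which `σ` and `τ` agree cancel; transposing makes them zero rows.
  rw [← Matrix.rank_transpose]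
  refine Matrix.rank_le_card_of_support_subset _ _ ?_
  rw [Function.support_subset_iff']
  intro j hj
  simp only [ne_eq, Finset.coe_filter, Finset.mem_univ, true_and, Set.mem_ofPred_eq,
    not_not] at hj
  ext i
  simp [permRep_apply, hj]

/-- For a maximal `T` disjoint from `σ(T)`, a moved point outside `T`, `σ(T)` and `σ⁻¹(T)` could be
added to `T`; so these three sets cover all moved points. -/
theorem exists_disjoint_image_of_perm {A : Type u} [Fintype A] [DecidableEq A]
    (σ : Equiv.Perm A) :
    ∃ T : Finset A, (∀ t ∈ T, σ t ∉ T) ∧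
      (Finset.univ.filter fun a => σ a ≠ a).card ≤ 3 * T.card := by
  obtain ⟨T, hT, hmax⟩ := Finset.exists_max_image
    (Finset.univ.filter fun T : Finset A => ∀ t ∈ T, σ t ∉ T) Finset.card ⟨∅, by simp⟩
  simp only [Finset.mem_filter, Finset.mem_univ, true_and] at hT hmax
  refine ⟨T, hT, ?_⟩
  have h : (Finset.univ.filter fun a => σ a ≠ a) ⊆ T ∪ T.image σ ∪ T.image σ.symm := by
    intro x hx
    rw [Finset.mem_filter] at hx
    by_contra hn
    simp only [Finset.mem_union, Finset.mem_image, not_or, not_exists, not_and] at hn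
    obtain ⟨⟨h1, h2⟩, h3⟩ := hn
    have h4 : σ x ∉ T := fun h => h3 _ h (σ.symm_apply_apply x)
    have := hmax (insert x T) (by
      intro t ht
      rw [Finset.mem_insert, not_or]
      rcases Finset.mem_insert.1 ht with rfl | ht
      · exact ⟨hx.2, h4⟩
      · exact ⟨h2 t ht, hT t ht⟩)
    rw [Finset.card_insert_of_notMem h1] at this
    omega
  have h1 := Finset.card_le_card h
  have h2 := Finset.card_union_le (T ∪ T.image σ) (T.image σ.symm)
  have h3 := Finset.card_union_le T (T.image σ)
  have h4 : (T.image σ).card ≤ T.card := Finset.card_image_le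
  have h5 : (T.image σ.symm).card ≤ T.card := Finset.card_image_le
  omega

/-- On a set `T` disjoint from `σ(T)`, the diagonal block of `P_σ - 1` is `-1`, so the rank is at
least `|T|` over any field. -/
theorem le_rank_permRep_sub_one {A : Type u} {K : Type v} [Fintype A] [DecidableEq A] [Field K]
    (σ : Equiv.Perm A) :
    (Finset.univ.filter fun a => σ a ≠ a).card ≤ 3 * (permRep A K σ - 1).rank := by
  obtain ⟨T, hT, hc⟩ := exists_disjoint_image_of_perm σ
  have h : (permRep A K σ - 1).submatrix (Subtype.val : T → A) (Subtype.val : T → A) = -1 := by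
    ext i j
    have hij : (i : A) ≠ σ j := fun h => hT j j.2 (h ▸ i.2)
    rw [Matrix.submatrix_apply, Matrix.sub_apply, permRep_apply, if_neg hij, zero_sub,
      Matrix.neg_apply, Matrix.one_apply, Matrix.one_apply]
    simp only [Subtype.ext_iff]
  have h1 := Matrix.rank_submatrix_le (permRep A K σ - 1) (Subtype.val : T → A)
    (Subtype.val : T → A)
  have hu : IsUnit (-1 : Matrix T T K) := isUnit_one.neg
  rw [h, Matrix.rank_of_isUnit _ hu, Fintype.card_coe] at h1
  omega

/-- Each column where `σ` and `τ` differ contributes two entries of modulus one. -/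
theorem sum_norm_permRep_sub {A : Type u} [Fintype A] [DecidableEq A] (σ τ : Equiv.Perm A) :
    ∑ i, ∑ j, ‖permRep A ℂ σ i j - permRep A ℂ τ i j‖ ^ 2
      = 2 * (Finset.univ.filter fun a => σ a ≠ τ a).card := by
  rw [Finset.sum_comm, Finset.card_filter]
  push_cast
  rw [Finset.mul_sum]
  refine Finset.sum_congr rfl fun j _ => ?_
  by_cases h : σ j = τ j
  · simp [permRep_apply, h]
  · have : ∀ i, ‖permRep A ℂ σ i j - permRep A ℂ τ i j‖ ^ 2
        = (if i = σ j then 1 else 0) + (if i = τ j then 1 else 0) := by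
      intro i
      rw [permRep_apply, permRep_apply]
      by_cases h1 : i = σ j
      · have h2 : i ≠ τ j := fun h2 => h (h1.symm.trans h2)
        simp [h1, h]
      · by_cases h2 : i = τ j
        · simp [if_neg h1, if_pos h2]
        · simp [h1, h2]
    simp only [this, Finset.sum_add_distrib, Finset.sum_ite_eq', Finset.mem_univ, if_true]
    rw [if_pos h]
    norm_num

end PermutationMatrices

/-! ### Equal-size direct sums of matrices -/

section AmplifiedSum

variable {m : Type u} {n : Type v} {R : Type w} [Fintype m] [Fintype n] [DecidableEq m]
  [DecidableEq n]

/-- The direct sum of two square matrices, repeated so that both summands have the same size. -/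
def matrixAmplifiedSum [Ring R] :
    Matrix m m R × Matrix n n R →+* Matrix (m × n ⊕ n × m) (m × n ⊕ n × m) R where
  toFun M := Matrix.fromBlocks (Matrix.blockDiagonal fun _ : n => M.1) 0 0
    (Matrix.blockDiagonal fun _ : m => M.2)
  map_one' := by
    rw [← Matrix.fromBlocks_one]
    congr 1 <;> exact Matrix.blockDiagonal_one
  map_mul' M N := by
    rw [Matrix.fromBlocks_multiply]
    simp [Matrix.blockDiagonal_mul]
  map_zero' := by
    rw [← Matrix.fromBlocks_zero]
    congr 1 <;> exact Matrix.blockDiagonal_zero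
  map_add' M N := by
    rw [Matrix.fromBlocks_add]
    congr 1
    · exact Matrix.blockDiagonal_add (fun _ : n => M.1) fun _ => N.1
    · simp
    · simp
    · exact Matrix.blockDiagonal_add (fun _ : m => M.2) fun _ => N.2

theorem matrixAmplifiedSum_apply [Ring R] (M : Matrix m m R × Matrix n n R) :
    matrixAmplifiedSum M = Matrix.fromBlocks (Matrix.blockDiagonal fun _ : n => M.1) 0 0
      (Matrix.blockDiagonal fun _ : m => M.2) := rfl

theorem star_matrixAmplifiedSum (M : Matrix m m ℂ × Matrix n n ℂ) :
    star (matrixAmplifiedSum M) = matrixAmplifiedSum (star M) := by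
  simp only [matrixAmplifiedSum_apply, Matrix.star_eq_conjTranspose,
    Matrix.fromBlocks_conjTranspose, Matrix.blockDiagonal_conjTranspose,
    Matrix.conjTranspose_zero, Prod.fst_star, Prod.snd_star]

theorem sum_norm_matrixAmplifiedSum (M : Matrix m m ℂ × Matrix n n ℂ) :
    ∑ i, ∑ j, ‖matrixAmplifiedSum M i j‖ ^ 2
      = Fintype.card n * ∑ i, ∑ j, ‖M.1 i j‖ ^ 2
        + Fintype.card m * ∑ i, ∑ j, ‖M.2 i j‖ ^ 2 := by
  simp only [matrixAmplifiedSum_apply, Fintype.sum_sum_type, Matrix.fromBlocks_apply₁₁,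
    Matrix.fromBlocks_apply₁₂, Matrix.fromBlocks_apply₂₁, Matrix.fromBlocks_apply₂₂,
    Matrix.zero_apply, norm_zero, Fintype.sum_prod_type, Matrix.blockDiagonal_apply,
    apply_ite norm, ite_pow, ne_eq, OfNat.ofNat_ne_zero, not_false_eq_true, zero_pow,
    Finset.sum_const_zero, add_zero, zero_add, Finset.sum_ite_eq, Finset.mem_univ, if_true,
    Finset.sum_const, Finset.card_univ, nsmul_eq_mul, Finset.mul_sum]

theorem exists_mul_mul_eq_diagonal {K : Type w} [Field K] (M : Matrix m m K) :
    ∃ (V U : Matrix m m K) (D : m → K), IsUnit V ∧ IsUnit U ∧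
      V * M * U = Matrix.diagonal D := by
  obtain ⟨V, U, e, hV, hU, h⟩ := Matrix.exists_rank_normal_form M
  refine ⟨V, U, Sum.elim (fun _ => 1) (fun _ => 0) ∘ e, hV, hU, ?_⟩
  rw [h, ← Matrix.submatrix_diagonal_equiv, ← Matrix.fromBlocks_diagonal, Matrix.diagonal_one,
    Matrix.diagonal_zero]

theorem rank_mul_mul_of_isUnit {K : Type w} [Field K] {V U : Matrix m m K} (M : Matrix m m K)
    (hV : IsUnit V) (hU : IsUnit U) : (V * M * U).rank = M.rank := by
  rw [Matrix.rank_mul_eq_left_of_isUnit_det _ _ ((Matrix.isUnit_iff_isUnit_det _).1 hU),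
    Matrix.rank_mul_eq_right_of_isUnit_det _ _ ((Matrix.isUnit_iff_isUnit_det _).1 hV)]

/-- Invertible factors on either side preserve rank, and the sum, being a ring homomorphism, sends
invertible pairs to invertible matrices. This reduces to diagonal blocks, where rank counts non-zero
entries. -/
theorem rank_matrixAmplifiedSum {K : Type w} [Field K] (M : Matrix m m K × Matrix n n K) :
    (matrixAmplifiedSum M).rank
      = Fintype.card n * M.1.rank + Fintype.card m * M.2.rank := by
  classical
  obtain ⟨V₁, U₁, D₁, hV₁, hU₁, h₁⟩ := exists_mul_mul_eq_diagonal M.1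
  obtain ⟨V₂, U₂, D₂, hV₂, hU₂, h₂⟩ := exists_mul_mul_eq_diagonal M.2
  have hV : IsUnit ((V₁, V₂) : Matrix m m K × Matrix n n K) := Prod.isUnit_iff.2 ⟨hV₁, hV₂⟩
  have hU : IsUnit ((U₁, U₂) : Matrix m m K × Matrix n n K) := Prod.isUnit_iff.2 ⟨hU₁, hU₂⟩
  rw [← rank_mul_mul_of_isUnit M.1 hV₁ hU₁, ← rank_mul_mul_of_isUnit M.2 hV₂ hU₂,
    ← rank_mul_mul_of_isUnit _ (hV.map matrixAmplifiedSum) (hU.map matrixAmplifiedSum),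
    ← map_mul, ← map_mul, Prod.mul_def, Prod.mul_def, h₁, h₂, matrixAmplifiedSum_apply,
    Matrix.blockDiagonal_diagonal, Matrix.blockDiagonal_diagonal, Matrix.fromBlocks_diagonal]
  simp only [Matrix.rank_diagonal, Fintype.card_subtype, Finset.card_filter,
    Fintype.sum_sum_type, Fintype.sum_prod_type, Sum.elim_inl, Sum.elim_inr, Finset.mul_sum]
  refine congrArg₂ (· + ·) (Finset.sum_congr rfl fun i _ => ?_)
    (Finset.sum_congr rfl fun i _ => ?_)
  · by_cases h : D₁ i = 0 <;> simp [h]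
  · by_cases h : D₂ i = 0 <;> simp [h]

end AmplifiedSum

/-! ### Linear sofic groups -/

section LinearSofic

theorem exists_generalLinearGroup_hom {H : Type*} [Group H] {A : Type*} [Fintype A]
    [DecidableEq A] [Nonempty A] {K : Type w} [Field K] (f : H →* Matrix A A K) :
    ∃ (n : ℕ+) (ρ : H →* Matrix.GeneralLinearGroup (Fin n) K),
      ∀ x y, rankMetric (ρ x) (ρ y) = ((f x - f y).rank : ℝ) / Fintype.card A := by
  obtain ⟨n, ⟨e⟩⟩ := exists_equiv_fin_pnat A
  refine ⟨n, MonoidHom.toHomUnits (((Matrix.reindexAlgEquiv K K e : _ →* _)).comp f), fun x y => ?_⟩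
  rw [rankMetric, ← Matrix.rank_reindex e e (f x - f y), Fintype.card_congr e, Fintype.card_fin]
  rfl

theorem IsLinearSoficGroup.symEnrichment (K : Type w) [Field K] {Γ : Type u} [Group Γ]
    {X : Type v} [MulAction Γ X] (hα : IsSoficAction Γ X) (hΓ : IsLinearSoficGroup K Γ) :
    IsLinearSoficGroup K (SymEnrichment Γ X) := by
  -- Rank distance to the identity is at least a third of Hamming distance, hence `1/6` from `1/2`.
  refine IsMetricApproximable.symEnrichment ⟨1 / 6, by norm_num, fun δ hδ => ⟨δ, hδ, ?_⟩⟩ ?_ hα hΓ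
  · intro A _ _ _
    have hA : (0 : ℝ) < Fintype.card A := Nat.cast_pos.2 Fintype.card_pos
    obtain ⟨n, ρ, hρ⟩ := exists_generalLinearGroup_hom (permRep A K)
    refine ⟨n, ρ, fun σ τ h => ?_, fun σ h => ?_⟩
    · refine lt_of_le_of_lt ?_ h
      rw [hρ, hammingMetric_eq_card_ne]
      gcongr
      exact rank_permRep_sub_le σ τ
    · rw [← map_one ρ, hρ, map_one, lt_div_iff₀ hA]
      rw [hammingMetric_eq_card_ne, lt_div_iff₀ hA] at h
      have h1 : ((Finset.univ.filter fun a => σ a ≠ (1 : Equiv.Perm A) a).card : ℝ)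
          ≤ 3 * (permRep A K σ - 1).rank := by
        exact_mod_cast le_rank_permRep_sub_one σ
      linarith
  · intro m n
    have hm : (0 : ℝ) < ((m : ℕ) : ℝ) := Nat.cast_pos.2 m.pos
    have hn : (0 : ℝ) < ((n : ℕ) : ℝ) := Nat.cast_pos.2 n.pos
    let f : Matrix.GeneralLinearGroup (Fin m) K × Matrix.GeneralLinearGroup (Fin n) K →* _ :=
      (matrixAmplifiedSum : _ →+* _).toMonoidHom.comp
        (MonoidHom.prodMap (Units.coeHom (Matrix (Fin m) (Fin m) K))
          (Units.coeHom (Matrix (Fin n) (Fin n) K)))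
    obtain ⟨k, ρ, hρ⟩ := exists_generalLinearGroup_hom f
    have hd : ∀ p q, rankMetric (ρ p) (ρ q) = (rankMetric p.1 q.1 + rankMetric p.2 q.2) / 2 := by
      intro p q
      have h : f p - f q = matrixAmplifiedSum (p.1.val - q.1.val, p.2.val - q.2.val) :=
        (map_sub matrixAmplifiedSum _ _).symm
      rw [hρ, h, rank_matrixAmplifiedSum, rankMetric, rankMetric]
      simp only [Fintype.card_sum, Fintype.card_prod, Fintype.card_fin]
      push_cast
      field_simp
      ring
    refine ⟨k, ρ, fun p q δ h1 h2 => ?_, fun p => ?_⟩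
    · rw [hd]
      linarith
    · rw [← map_one ρ, hd, Prod.fst_one, Prod.snd_one]
      have h1 : 0 ≤ rankMetric p.1 1 := by unfold rankMetric; positivity
      have h2 : 0 ≤ rankMetric p.2 1 := by unfold rankMetric; positivity
      constructor <;> linarith

end LinearSofic

/-! ### Hyperlinear groups -/

section Hyperlinear

theorem exists_unitaryGroup_hom {H : Type*} [Group H] {A : Type*} [Fintype A]
    [DecidableEq A] [Nonempty A] (f : H →* Matrix A A ℂ) (hf : ∀ x, f x * star (f x) = 1) :
    ∃ (n : ℕ+) (ρ : H →* Matrix.unitaryGroup (Fin n) ℂ), ∀ x y, hilbertSchmidtMetric (ρ x) (ρ y)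
      = Real.sqrt ((∑ i, ∑ j, ‖f x i j - f y i j‖ ^ 2) / Fintype.card A) := by
  obtain ⟨n, ⟨e⟩⟩ := exists_equiv_fin_pnat A
  let g : H →* Matrix (Fin n) (Fin n) ℂ :=
    ((Matrix.reindexAlgEquiv ℂ ℂ e : _ →* _)).comp f
  have hstar : ∀ x, star (g x) = Matrix.reindexAlgEquiv ℂ ℂ e (star (f x)) := fun _ => rfl
  refine ⟨n, g.codRestrict _ fun x => ?_, fun x y => ?_⟩
  · rw [Matrix.mem_unitaryGroup_iff, hstar]
    change Matrix.reindexAlgEquiv ℂ ℂ e (f x) * _ = 1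
    rw [← map_mul, hf, map_one]
  · rw [hilbertSchmidtMetric, one_div, inv_mul_eq_div, Fintype.card_congr e, Fintype.card_fin]
    congr 2
    rw [← e.symm.sum_comp]
    refine Finset.sum_congr rfl fun i _ => ?_
    rw [← e.symm.sum_comp]
    rfl

theorem IsHyperlinearGroup.symEnrichment {Γ : Type u} [Group Γ]
    {X : Type v} [MulAction Γ X] (hα : IsSoficAction Γ X) (hΓ : IsHyperlinearGroup Γ) :
    IsHyperlinearGroup (SymEnrichment Γ X) := by
  refine IsMetricApproximable.symEnrichment
    -- The Hilbert-Schmidt distance of permutation matrices is the square root of twice the Hamming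
    -- distance, hence `δ² / 2`.
    ⟨1 / 2, by norm_num, fun δ hδ => ⟨δ ^ 2 / 2, by positivity, ?_⟩⟩ ?_ hα hΓ
  · intro A _ _ _
    obtain ⟨n, ρ, hρ⟩ := exists_unitaryGroup_hom (permRep A ℂ) (permRep_mul_star A)
    have hd : ∀ σ τ, hilbertSchmidtMetric (ρ σ) (ρ τ) = Real.sqrt (2 * hammingMetric σ τ) := by
      intro σ τ
      rw [hρ, sum_norm_permRep_sub, hammingMetric_eq_card_ne, mul_div_assoc]
    refine ⟨n, ρ, fun σ τ h => ?_, fun σ h => ?_⟩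
    · rw [hd, Real.sqrt_lt' hδ]
      linarith
    · rw [← map_one ρ, hd]
      refine Real.lt_sqrt_of_sq_lt ?_
      linarith
  · intro m n
    have hm : (0 : ℝ) < ((m : ℕ) : ℝ) := Nat.cast_pos.2 m.pos
    have hn : (0 : ℝ) < ((n : ℕ) : ℝ) := Nat.cast_pos.2 n.pos
    let f : Matrix.unitaryGroup (Fin m) ℂ × Matrix.unitaryGroup (Fin n) ℂ →* _ :=
      (matrixAmplifiedSum : _ →+* _).toMonoidHom.comp
        (MonoidHom.prodMap (Matrix.unitaryGroup (Fin m) ℂ).subtype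
          (Matrix.unitaryGroup (Fin n) ℂ).subtype)
    have hf : ∀ p, f p * star (f p) = 1 := by
      intro p
      change matrixAmplifiedSum (p.1.1, p.2.1) * star (matrixAmplifiedSum (p.1.1, p.2.1)) = 1
      rw [star_matrixAmplifiedSum, ← map_mul]
      refine (congrArg _ (Prod.ext ?_ ?_)).trans (map_one _)
      · exact Matrix.mem_unitaryGroup_iff.1 p.1.2
      · exact Matrix.mem_unitaryGroup_iff.1 p.2.2
    obtain ⟨k, ρ, hρ⟩ := exists_unitaryGroup_hom f hf
    have hd : ∀ p q, hilbertSchmidtMetric (ρ p) (ρ q) =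
        Real.sqrt ((hilbertSchmidtMetric p.1 q.1 ^ 2 + hilbertSchmidtMetric p.2 q.2 ^ 2) / 2) := by
      intro p q
      have h : f p - f q = matrixAmplifiedSum (p.1.1 - q.1.1, p.2.1 - q.2.1) :=
        (map_sub matrixAmplifiedSum _ _).symm
      simp only [← Matrix.sub_apply] at hρ
      rw [hρ, h, sum_norm_matrixAmplifiedSum, hilbertSchmidtMetric, hilbertSchmidtMetric,
        Real.sq_sqrt (by positivity), Real.sq_sqrt (by positivity)]
      simp only [Fintype.card_sum, Fintype.card_prod, Fintype.card_fin, Matrix.sub_apply]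
      congr 1
      push_cast
      field_simp
      ring
    refine ⟨k, ρ, fun p q δ h1 h2 => ?_, fun p => ?_⟩
    · have h3 : 0 ≤ hilbertSchmidtMetric p.1 q.1 := Real.sqrt_nonneg _
      have h4 : 0 ≤ hilbertSchmidtMetric p.2 q.2 := Real.sqrt_nonneg _
      rw [hd, Real.sqrt_lt' (h3.trans_lt h1)]
      nlinarith
    · rw [← map_one ρ, hd, Prod.fst_one, Prod.snd_one]
      -- The root mean square is at least each distance divided by `√2`, hence at least half of it.
      constructor <;> refine Real.le_sqrt_of_sq_le ?_ <;>
        nlinarith [sq_nonneg (hilbertSchmidtMetric p.1 1), sq_nonneg (hilbertSchmidtMetric p.2 1)]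

end Hyperlinear

theorem mainTheorem10 {Γ : Type u} [Group Γ] {X : Type v} [MulAction Γ X]
    (hα : IsSoficAction Γ X) :
    (IsSoficGroup Γ →
      IsSoficGroup (SymEnrichment Γ X) ∧ IsSoficGroup (AltEnrichment Γ X)) ∧
    (∀ (K : Type w) [Field K], IsLinearSoficGroup K Γ →
      IsLinearSoficGroup K (SymEnrichment Γ X) ∧ IsLinearSoficGroup K (AltEnrichment Γ X)) ∧
    (IsHyperlinearGroup Γ →
      IsHyperlinearGroup (SymEnrichment Γ X) ∧ IsHyperlinearGroup (AltEnrichment Γ X)) ∧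
    (IsWeaklySoficGroup Γ →
      IsWeaklySoficGroup (SymEnrichment Γ X) ∧ IsWeaklySoficGroup (AltEnrichment Γ X)) := by
  have halt := altToSymEnrichment_injective Γ X
  refine ⟨fun h => ?_, fun K _ h => ?_, fun h => ?_, fun h => ?_⟩
  · exact ⟨h.symEnrichment hα, (h.symEnrichment hα).of_injective _ halt⟩
  · have h' := IsLinearSoficGroup.symEnrichment K hα h
    exact ⟨h', h'.of_injective _ halt⟩
  · exact ⟨h.symEnrichment hα, (h.symEnrichment hα).of_injective _ halt⟩
  · exact ⟨h.symEnrichment hα, (h.symEnrichment hα).of_injective _ halt⟩
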